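/- All spaces are Hausdorff. A space is $(<\kappa)$-compact if every open cover has a subcover of size $<\kappa$; $w(X)$ denotes the least cardinality of a base of $X$. For a family of spaces $(X_i)_{i\in I}$, the $(<\kappa)$-box topology on $\prod_{i\in I} X_i$ has as a base the sets $\prod_{i\in I} O_i$ with every $O_i\subseteq X_i$ open and $|\{i\in I: O_i\ne X_i\}|<\kappa$. A filter is $(<\kappa)$-complete if it is closed under intersections of fewer than $\kappa$ of its members, and it measures a family $\mathcal A$ of sets if it contains $A$ or the complement of $A$ for every $A\in\mathcal A$. A GO-space is a Hausdorff space equipped with a linear order and having a base of order-convex sets. A cardinal $\kappa$ is weakly compact if it is (strongly) inaccessible and has the tree property: every tree of cardinality $\kappa$, all of whose levels have cardinality $<\kappa$, has a branch of cardinality $\kappa$. **Theorem 5.1.** Suppose that $\kappa=\kappa^{<\kappa}>\aleph_0$. Then the following are equivalent: 1. $\kappa$ is a weakly compact cardinal. 2. For every family of at most $\kappa$ many $(<\kappa)$-compact spaces, each of weight $\le\kappa$, the product of the family with the $(<\kappa)$-box topology is $(<\kappa)$-compact. 3. $2^\kappa=\{0,1\}^\kappa$ (with $\{0,1\}$ discrete)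 is $(<\kappa)$-compact in the $(<\kappa)$-box topology. 4. $\kappa$ has the $\kappa$-filter extension property: for every family $\mathcal A$ of at most $\kappa$ many subsets of $2^\kappa$, every proper $(<\kappa)$-complete filter over $2^\kappa$ generated by at most $\kappa$ many elements can be extended to a proper $(<\kappa)$-complete filter over $2^\kappa$ that measures $\mathcal A$. 5. For every family of at most $\kappa$ many $(<\kappa)$-compact spaces, each of weight $\le\kappa$, the Tychonoff product of the family is $(<\kappa)$-compact. 6. $\kappa$ is weakly square compact: for every $(<\kappa)$-compact space $X$ with $w(X)\le\kappa$, the square $X\times X$ is $(<\kappa)$-compact. 7. The product of any two $(<\kappa)$-compact GO-spaces of weight $\le\kappa$ is $(<\kappa)$-compact. -/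

import Mathlib

open scoped Cardinal
open Set TopologicalSpace

universe u v

/-- A topological space is `(<κ)`-compact if every open cover of it has a subcover of cardinality
strictly less than `κ`. -/
def LtCompact (κ : Cardinal.{u}) (X : Type u) [TopologicalSpace X] : Prop :=
  ∀ 𝒰 : Set (Set X), (∀ U ∈ 𝒰, IsOpen U) → ⋃₀ 𝒰 = univ →
    ∃ 𝒱 : Set (Set X), 𝒱 ⊆ 𝒰 ∧ #𝒱 < κ ∧ ⋃₀ 𝒱 = univ

/-- The weight of a topological space: the least cardinality of a base. -/
noncomputable def topWeight (X : Type u) [TopologicalSpace X] : Cardinal.{u} :=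
  sInf {c : Cardinal.{u} | ∃ B : Set (Set X), IsTopologicalBasis B ∧ #B = c}

/-- The product of the spaces `X i`, to be equipped with the `(<θ)`-box topology. -/
def BoxProduct (_θ : Cardinal.{u}) {ι : Type u} (X : ι → Type v) : Type (max u v) :=
  ∀ i, X i

/-- The `(<θ)`-box topology, generated by the products of open sets `O i` such that `O i` is the
whole space `X i` for all but fewer than `θ` many `i`. -/
instance BoxProduct.instTopologicalSpace (θ : Cardinal.{u}) {ι : Type u} (X : ι → Type v) [∀ i, TopologicalSpace (X i)] :
    TopologicalSpace (BoxProduct θ X) :=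
  generateFrom {S : Set (∀ i, X i) | ∃ O : ∀ i, Set (X i),
    (∀ i, IsOpen (O i)) ∧ #{i : ι | O i ≠ univ} < θ ∧ S = Set.pi univ O}

/-- A tree: a partial order in which the predecessors of every element are well-ordered. -/
def IsSetTree (T : Type u) [PartialOrder T] : Prop :=
  ∀ x : T, IsWellOrder (Set.Iio x) (· < ·)

/-- The `α`-th level of a tree: the elements whose set of predecessors has order type `α`. -/
def treeLevel (T : Type u) [PartialOrder T] (α : Ordinal.{u}) : Set T :=
  {x : T | Nonempty (Set.Iio x ≃o Set.Iio α)}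

/-- The tree property: every tree of cardinality `κ` all of whose levels have cardinality less
than `κ` has a branch (a maximal chain) of cardinality `κ`. -/
def TreeProperty (κ : Cardinal.{u}) : Prop :=
  ∀ (T : Type u) [PartialOrder T], IsSetTree T → #T = κ →
    (∀ α : Ordinal.{u}, #(treeLevel T α) < κ) →
    ∃ b : Set T, IsMaxChain (· ≤ ·) b ∧ #b = κ

/-- A cardinal is weakly compact if it is (strongly) inaccessible and has the tree property. -/
def IsWeaklyCompactCardinal (κ : Cardinal.{u}) : Prop :=
  κ.IsInaccessible ∧ TreeProperty κ

/-- The set `2^lam` of all functions from the cardinal `lam` to `2 = {0, 1}`. -/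
abbrev TwoPow (lam : Cardinal.{u}) : Type u := lam.ord.ToType → Bool

/-- The `lam`-filter extension property of `κ`: for every family `𝒜` of at most `lam` many subsets
of `2^lam`, every proper `(<κ)`-complete filter over `2^lam` generated by at most `lam` many
elements extends to a proper `(<κ)`-complete filter over `2^lam` which measures `𝒜`. (For Mathlib's
reversed order on filters, `G ≤ F` means that `G` contains `F` as a family of sets.) -/
def FilterExtensionProperty (κ lam : Cardinal.{u}) : Prop :=
  ∀ 𝒜 : Set (Set (TwoPow lam)), #𝒜 ≤ lam →
    ∀ F : Filter (TwoPow lam), F.NeBot → CardinalInterFilter F κ →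
      (∃ ℰ : Set (Set (TwoPow lam)), #ℰ ≤ lam ∧ F = Filter.generate ℰ) →
      ∃ G : Filter (TwoPow lam), G.NeBot ∧ CardinalInterFilter G κ ∧ G ≤ F ∧
        ∀ A ∈ 𝒜, A ∈ G ∨ Aᶜ ∈ G

/-- `κ` is `lam`-square compact: the square of every `(<κ)`-compact Hausdorff space of weight at
most `lam` is `(<κ)`-compact. -/
def SquareCompact (κ lam : Cardinal.{u}) : Prop :=
  ∀ (X : Type u) [TopologicalSpace X] [T2Space X],
    LtCompact κ X → topWeight X ≤ lam → LtCompact κ (X × X)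

/-- `κ` is weakly square compact if it is `κ`-square compact. -/
def WeaklySquareCompact (κ : Cardinal.{u}) : Prop := SquareCompact κ κ

/-- A generalised ordered space: a Hausdorff space with a linear order and with a base of
order-convex sets. -/
class GOSpace (X : Type u) [TopologicalSpace X] [LinearOrder X] : Prop extends T2Space X where
  exists_convex_basis :
    ∃ B : Set (Set X), IsTopologicalBasis B ∧ ∀ s ∈ B, s.OrdConnected

/-! Three implications carry the weight: weak compactness yields filter extensions, compactness of
`2 ^ κ` yields weak compactness, and GO-squares control `2 ^ κ`.

Given a `(<κ)`-complete proper filter and a `κ`-sequence of sets, consider the tree of yes/no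
decisions on initial segments that are compatible with the filter (`DecisionTree`). Inaccessibility
makes its levels small, completeness makes those below `κ` nonempty, and a long branch decides every
set. The filter it generates measures the sequence. Measuring the basic open sets of all factors
makes that filter converge in each coordinate, hence in the box product. Conversely, `2 ^ κ` is
compact once the filter attached to a cover by cylinders can be extended to measure all coordinates.

Compactness of `2 ^ κ` forces a strong limit, since the cylinders over a fixed small set of
coordinates form an irreducible cover. It also forces branches: predecessor sets of tree nodes are
points of `2 ^ κ`, and having a branch up to each level is a closed condition.

For GO-spaces, take a cover of `2 ^ κ` without small subcover. The minimal cylinders contained in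
members of the cover partition `2 ^ κ`; one representative of each, ordered lexicographically, gives
a complete linear order `L` of size `κ`. Every subset of `L` has small cofinality and coinitiality,
for otherwise it would converge to some `y`, whose minimal cylinder holds only one representative.
So the Sorgenfrey topologies on `L` and its reverse are `(<κ)`-compact, while their product contains
a closed discrete diagonal of size `κ`. -/

/-! ### Cardinal arithmetic from `κ ^< κ = κ` -/

section Cardinals

variable {κ : Cardinal.{u}}

theorem mk_Iio_toType_lt (a : κ.ord.ToType) : #(Iio a) < κ := by
  simpa using Cardinal.mk_Iio_lt a

theorem isRegular_of_powerlt_eq (hκ : κ ^< κ = κ) (hω : ℵ₀ < κ) : κ.IsRegular := by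
  refine ⟨hω.le, ?_⟩
  by_contra! h
  exact absurd (Cardinal.lt_power_cof_ord hω.le)
    (not_lt.2 ((Cardinal.le_powerlt κ h).trans hκ.le))

theorem Cardinal.IsRegular.exists_forall_lt (hr : κ.IsRegular) {ι : Type u} (hι : #ι < κ)
    (f : ι → κ.ord.ToType) : ∃ b, ∀ i, f i < b := by
  have h1 : ⨆ i, (Order.succ (Ordinal.typein (α := κ.ord.ToType) (· < ·) (f i))) < κ.ord := by
    refine Ordinal.iSup_lt_of_lt_cof (hι.trans_le hr.le_cof_ord) fun i => ?_
    exact (Cardinal.isSuccLimit_ord hr.aleph0_le).succ_lt (Ordinal.typein_lt_self _)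
  refine ⟨Ordinal.ToType.mk ⟨_, h1⟩, fun i => ?_⟩
  rw [← OrderIso.symm_apply_lt, ← Subtype.coe_lt_coe]
  refine lt_of_lt_of_le (Order.lt_succ _) (Ordinal.le_iSup
    (fun i => Order.succ (Ordinal.typein (α := κ.ord.ToType) (· < ·) (f i))) i)

theorem Cardinal.IsRegular.exists_gt (hr : κ.IsRegular) (a : κ.ord.ToType) : ∃ b, a < b := by
  obtain ⟨b, hb⟩ := hr.exists_forall_lt (ι := PUnit)
    (by simpa using Cardinal.one_lt_aleph0.trans_le hr.aleph0_le) (fun _ => a)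
  exact ⟨b, hb ⟨⟩⟩

theorem Cardinal.IsRegular.exists_forall_mem_lt (hr : κ.IsRegular) {s : Set κ.ord.ToType}
    (hs : #s < κ) : ∃ b, ∀ i ∈ s, i < b := by
  obtain ⟨b, hb⟩ := hr.exists_forall_lt hs (fun i => i.1)
  exact ⟨b, fun i hi => hb ⟨i, hi⟩⟩

theorem mk_sigma_Iio_fun_le (hκ : κ ^< κ = κ) (hω : ℵ₀ < κ) {Z : Type u} (hZ : #Z ≤ κ) :
    #(Σ a : κ.ord.ToType, (Iio a → Z)) ≤ κ := by
  rw [Cardinal.mk_sigma]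
  refine (Cardinal.sum_le_mk_mul_iSup _).trans ?_
  rw [Cardinal.mk_ord_toType]
  refine (mul_le_mul_right (ciSup_le' (a := κ) fun a => ?_) κ).trans (Cardinal.mul_eq_self hω.le).le
  rw [← Cardinal.power_def]
  exact (Cardinal.power_le_power_right hZ).trans
    ((Cardinal.le_powerlt κ (mk_Iio_toType_lt a)).trans hκ.le)

theorem mk_sigma_Iio_bool_le (hκ : κ ^< κ = κ) (hω : ℵ₀ < κ) :
    #(Σ a : κ.ord.ToType, (Iio a → Bool)) ≤ κ := by
  refine le_trans ?_ (mk_sigma_Iio_fun_le hκ hω (Z := ULift.{u} Bool)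
    ((Cardinal.mk_lt_aleph0).trans hω).le)
  exact Cardinal.mk_le_of_surjective (f := fun p => ⟨p.1, fun b => (p.2 b).down⟩)
    fun p => ⟨⟨p.1, fun b => ⟨p.2 b⟩⟩, rfl⟩

/-- There are at most `κ` many subsets of size `< κ` of a set of size `≤ κ`. -/
theorem mk_small_subsets_le (hκ : κ ^< κ = κ) (hω : ℵ₀ < κ) {Z : Type u} (hZ : #Z ≤ κ) :
    #{s : Set Z | #s < κ} ≤ κ := by
  refine le_trans ?_ (mk_sigma_Iio_fun_le hκ hω hZ)
  refine Cardinal.mk_le_of_surjective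
    (f := fun p : {p : Σ a : κ.ord.ToType, (Iio a → Z) // #(range p.2) < κ} =>
      (⟨range p.1.2, p.2⟩ : {s : Set Z | #s < κ})) ?_ |>.trans (Cardinal.mk_subtype_le _)
  rintro ⟨s, hs⟩
  -- The initial segment below `o` has exactly as many elements as `s`, so it can enumerate `s`.
  let o : κ.ord.ToType := Ordinal.ToType.mk ⟨(#s).ord, Cardinal.ord_lt_ord.2 hs⟩
  have ho : #(Iio o) = #s := by
    refine (Ordinal.card_typein (r := ((· < ·) : κ.ord.ToType → κ.ord.ToType → Prop)) o).symm.trans ?_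
    rw [show Ordinal.typein ((· < ·) : κ.ord.ToType → κ.ord.ToType → Prop) o = (#s).ord from
      Ordinal.typein_enum _ _, Cardinal.card_ord]
  obtain ⟨e⟩ := Cardinal.eq.1 ho
  have : range (fun i => (e i : Z)) = s := by
    rw [← Function.comp_def, EquivLike.range_comp]; simp
  exact ⟨⟨⟨o, fun i => e i⟩, by simpa [this] using hs⟩, by simpa using this⟩

theorem Cardinal.IsRegular.mk_biUnion_lt (hr : κ.IsRegular) {α β : Type u} {s : Set α}
    (hs : #s < κ) {t : α → Set β} (ht : ∀ a ∈ s, #(t a) < κ) : #(⋃ a ∈ s, t a : Set β) < κ :=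
  (Cardinal.card_biUnion_lt_iff_forall_of_isRegular hr hs (t := fun a _ => t a)).2 ht

end Cardinals

/-! ### `(<κ)`-compactness, weight, and the filter of a cover -/

section Compactness

variable {κ : Cardinal.{u}} {X Y : Type u} [TopologicalSpace X] [TopologicalSpace Y]

theorem LtCompact.exists_subcover (h : LtCompact κ X) {ι : Type u} (U : ι → Set X)
    (hU : ∀ i, IsOpen (U i)) (hc : ∀ x, ∃ i, x ∈ U i) :
    ∃ J : Set ι, #J < κ ∧ ∀ x, ∃ i ∈ J, x ∈ U i := by
  obtain ⟨𝒱, hs, hlt, hcov⟩ := h (range U) (forall_mem_range.2 hU)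
    (eq_univ_of_forall fun x => by simpa using hc x)
  choose f hf using fun V : 𝒱 => hs V.2
  refine ⟨range f, Cardinal.mk_range_le.trans_lt hlt, fun x => ?_⟩
  obtain ⟨V, hV, hx⟩ := (hcov ▸ mem_univ x : x ∈ ⋃₀ 𝒱)
  exact ⟨f ⟨V, hV⟩, mem_range_self _, by rwa [hf]⟩

theorem ltCompact_of_forall {κ : Cardinal.{u}} {X : Type u} [TopologicalSpace X]
    (h : ∀ (ι : Type u) (U : ι → Set X), (∀ i, IsOpen (U i)) → (∀ x, ∃ i, x ∈ U i) →
      ∃ J : Set ι, #J < κ ∧ ∀ x, ∃ i ∈ J, x ∈ U i) : LtCompact κ X := by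
  intro 𝒰 ho hc
  obtain ⟨J, hJ, hcov⟩ := h 𝒰 (fun U => U) (fun U => ho U U.2) (fun x => by
    obtain ⟨U, hU, hx⟩ := (hc ▸ mem_univ x : x ∈ ⋃₀ 𝒰)
    exact ⟨⟨U, hU⟩, hx⟩)
  refine ⟨(↑) '' J, by simp, Cardinal.mk_image_le.trans_lt hJ, eq_univ_of_forall fun x => ?_⟩
  obtain ⟨U, hU, hx⟩ := hcov x
  exact ⟨U, mem_image_of_mem _ hU, hx⟩

theorem LtCompact.of_surjective (h : LtCompact κ X) {f : X → Y} (hf : Continuous f)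
    (hs : Function.Surjective f) : LtCompact κ Y := by
  refine ltCompact_of_forall fun ι U hU hc => ?_
  obtain ⟨J, hJ, hcov⟩ := h.exists_subcover (fun i => f ⁻¹' U i) (fun i => (hU i).preimage hf)
    (fun x => hc (f x))
  refine ⟨J, hJ, fun y => ?_⟩
  obtain ⟨x, rfl⟩ := hs y
  exact hcov x

theorem LtCompact.of_isClosedEmbedding (h : LtCompact κ Y) {f : X → Y}
    (hf : Topology.IsClosedEmbedding f) : LtCompact κ X := by
  refine ltCompact_of_forall fun ι U hU hc => ?_
  choose V hV hVU using fun i => hf.isInducing.isOpen_iff.1 (hU i)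
  obtain ⟨J, hJ, hcov⟩ := h.exists_subcover (fun o : Option ι => o.elim (range f)ᶜ V)
    (by rintro (_ | i) <;> [exact hf.isClosed_range.isOpen_compl; exact hV i]) (fun y => by
      by_cases hy : y ∈ range f
      · obtain ⟨x, rfl⟩ := hy
        obtain ⟨i, hi⟩ := hc x
        exact ⟨some i, by simpa [← hVU] using hi⟩
      · exact ⟨none, hy⟩)
  refine ⟨some ⁻¹' J, (Cardinal.mk_preimage_of_injective _ _ (Option.some_injective _)).trans_lt hJ,
    fun x => ?_⟩
  obtain ⟨_ | i, hi, hx⟩ := hcov (f x)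
  · simp at hx
  · exact ⟨i, hi, by rw [← hVU]; exact hx⟩

theorem LtCompact.sum (hω : ℵ₀ < κ) (hX : LtCompact κ X) (hY : LtCompact κ Y) :
    LtCompact κ (X ⊕ Y) := by
  refine ltCompact_of_forall fun ι U hU hc => ?_
  obtain ⟨J, hJ, hJc⟩ := hX.exists_subcover (fun i => Sum.inl ⁻¹' U i)
    (fun i => (hU i).preimage continuous_inl) (fun x => hc _)
  obtain ⟨J', hJ', hJc'⟩ := hY.exists_subcover (fun i => Sum.inr ⁻¹' U i)
    (fun i => (hU i).preimage continuous_inr) (fun x => hc _)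
  refine ⟨J ∪ J', (Cardinal.mk_union_le _ _).trans_lt (Cardinal.add_lt_of_lt hω.le hJ hJ'), ?_⟩
  rintro (x | x)
  · obtain ⟨i, hi, h⟩ := hJc x
    exact ⟨i, .inl hi, h⟩
  · obtain ⟨i, hi, h⟩ := hJc' x
    exact ⟨i, .inr hi, h⟩

theorem ltCompact_of_finite [Finite X] (hω : ℵ₀ < κ) : LtCompact κ X := by
  refine ltCompact_of_forall fun ι U _ hc => ?_
  choose f hf using hc
  exact ⟨range f, (Cardinal.mk_range_le.trans_lt (Cardinal.mk_lt_aleph0)).trans hω,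
    fun x => ⟨f x, mem_range_self _, hf x⟩⟩

theorem exists_basis_card_eq_topWeight (X : Type u) [TopologicalSpace X] :
    ∃ B : Set (Set X), IsTopologicalBasis B ∧ #B = topWeight X :=
  csInf_mem (s := {c : Cardinal.{u} | ∃ B : Set (Set X), IsTopologicalBasis B ∧ #B = c})
    ⟨_, _, isTopologicalBasis_opens, rfl⟩

theorem topWeight_le {B : Set (Set X)} (hB : IsTopologicalBasis B) : topWeight X ≤ #B :=
  csInf_le' ⟨B, hB, rfl⟩

theorem topWeight_le_of_finite [Finite X] (hω : ℵ₀ < κ) : topWeight X ≤ κ :=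
  (topWeight_le isTopologicalBasis_opens).trans
    ((Cardinal.mk_lt_aleph0).trans hω).le

theorem topWeight_sum_le (hω : ℵ₀ < κ) (hX : topWeight X ≤ κ) (hY : topWeight Y ≤ κ) :
    topWeight (X ⊕ Y) ≤ κ := by
  obtain ⟨B, hB, hBc⟩ := exists_basis_card_eq_topWeight X
  obtain ⟨C, hC, hCc⟩ := exists_basis_card_eq_topWeight Y
  refine (topWeight_le (hB.sum hC)).trans ((Cardinal.mk_union_le _ _).trans
    (Cardinal.add_le_of_le hω.le ?_ ?_))
  · exact Cardinal.mk_image_le.trans (hBc.trans_le hX)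
  · exact Cardinal.mk_image_le.trans (hCc.trans_le hY)

/-- The filter generated by the complements of unions of fewer than `κ` members of `𝒰`. -/
def smallCoverFilter (hr : κ.IsRegular) {X : Type u} (𝒰 : Set (Set X)) : Filter X where
  sets := {S | ∃ 𝒱 ⊆ 𝒰, #𝒱 < κ ∧ Sᶜ ⊆ ⋃₀ 𝒱}
  univ_sets := ⟨∅, by simp, by simpa using hr.pos, by simp⟩
  sets_of_superset := by
    rintro S T ⟨𝒱, h, hc, hS⟩ hST
    exact ⟨𝒱, h, hc, (compl_subset_compl.2 hST).trans hS⟩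
  inter_sets := by
    rintro S T ⟨𝒱, h, hc, hS⟩ ⟨𝒲, h', hc', hT⟩
    refine ⟨𝒱 ∪ 𝒲, union_subset h h',
      (Cardinal.mk_union_le _ _).trans_lt (Cardinal.add_lt_of_lt hr.aleph0_le hc hc'), ?_⟩
    rw [compl_inter, sUnion_union]
    exact union_subset_union hS hT

theorem cardinalInterFilter_smallCoverFilter (hr : κ.IsRegular) {X : Type u} (𝒰 : Set (Set X)) :
    CardinalInterFilter (smallCoverFilter hr 𝒰) κ where
  cardinal_sInter_mem 𝒮 h𝒮 h := by
    choose! f hf hfc hfs using h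
    refine ⟨⋃ s ∈ 𝒮, f s, iUnion₂_subset hf, hr.mk_biUnion_lt h𝒮 hfc, ?_⟩
    rw [compl_sInter, sUnion_image]
    refine iUnion₂_subset fun s hs => (hfs s hs).trans (sUnion_subset_sUnion ?_)
    exact subset_biUnion_of_mem hs

theorem compl_mem_smallCoverFilter (hr : κ.IsRegular) {X : Type u} {𝒰 : Set (Set X)} {U : Set X}
    (hU : U ∈ 𝒰) : Uᶜ ∈ smallCoverFilter hr 𝒰 :=
  ⟨{U}, by simpa, by simpa using Cardinal.one_lt_aleph0.trans_le hr.aleph0_le, by simp⟩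

/-- A counterexample to compactness becomes a proper `(<κ)`-complete filter; a member of the cover
belonging to an extension of it is then contradictory. -/
theorem neBot_smallCoverFilter (hr : κ.IsRegular) {X : Type u} {𝒰 : Set (Set X)}
    (h : ∀ 𝒱 ⊆ 𝒰, #𝒱 < κ → ⋃₀ 𝒱 ≠ univ) : (smallCoverFilter hr 𝒰).NeBot := by
  refine ⟨fun hb => ?_⟩
  rw [← Filter.empty_mem_iff_bot] at hb
  revert hb
  rintro ⟨𝒱, hs, hc, hu⟩
  exact h 𝒱 hs hc (by simpa [univ_subset_iff] using hu)

end Compactness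

/-! ### Truncated 0-1 sequences -/

section Cut

variable {κ : Cardinal.{u}}

/-- The function which agrees with `s` below `a` and vanishes from `a` on. -/
noncomputable def cut (s : κ.ord.ToType → Bool) (a : κ.ord.ToType) : κ.ord.ToType → Bool :=
  fun b => if b < a then s b else false

theorem cut_of_lt {s : κ.ord.ToType → Bool} {a b : κ.ord.ToType} (h : b < a) : cut s a b = s b :=
  if_pos h

theorem cut_of_le {s : κ.ord.ToType → Bool} {a b : κ.ord.ToType} (h : a ≤ b) :
    cut s a b = false :=
  if_neg h.not_gt

theorem cut_congr {s t : κ.ord.ToType → Bool} {a : κ.ord.ToType} (h : ∀ b < a, s b = t b) :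
    cut s a = cut t a := by
  funext b
  by_cases hb : b < a
  · simp [cut, hb, h b hb]
  · simp [cut, hb]

theorem mk_range_cut_le (a : κ.ord.ToType) :
    #(range fun s : κ.ord.ToType → Bool => cut s a) ≤ 2 ^ #(Iio a) := by
  rw [show (2 : Cardinal.{u}) ^ #(Iio a) = #(Iio a → Bool) by simp]
  refine Cardinal.mk_le_of_injective (f := fun s b => s.1 b) ?_
  rintro ⟨_, s, rfl⟩ ⟨_, t, rfl⟩ h
  refine Subtype.ext (cut_congr fun b hb => ?_)
  simpa [cut, show b < a from hb] using congrFun h ⟨b, hb⟩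

end Cut

/-! ### Decision trees and extension of filters -/

section DecisionTree

variable {κ : Cardinal.{u}} {X : Type u}

/-- The tree of those ways to decide an initial segment of a sequence of sets which are compatible
with a filter. -/
def DecisionTree (F : Filter X) (A : κ.ord.ToType → Set X) : Type u :=
  {p : κ.ord.ToType × (κ.ord.ToType → Bool) // (∀ b, p.1 ≤ b → p.2 b = false) ∧
    ∃ᶠ x in F, ∀ b < p.1, (x ∈ A b ↔ p.2 b = true)}

namespace DecisionTree

variable {F : Filter X} {A : κ.ord.ToType → Set X}

/-- The length of the sequence of decisions. -/
def len (p : DecisionTree F A) : κ.ord.ToType := p.1.1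

/-- The sequence of decisions. -/
def dec (p : DecisionTree F A) : κ.ord.ToType → Bool := p.1.2

/-- Padding with `false` beyond the length leaves no freedom there. -/
theorem eq_of_len_eq {p q : DecisionTree F A} (h : p.len = q.len) (h' : ∀ b < p.len, p.dec b = q.dec b) :
    p = q := by
  refine Subtype.ext (Prod.ext h (funext fun b => ?_))
  rcases lt_or_ge b p.len with hb | hb
  · exact h' b hb
  · exact (p.2.1 b hb).trans (q.2.1 b (h.symm.le.trans hb)).symm

instance : PartialOrder (DecisionTree F A) where
  le p q := p.len ≤ q.len ∧ ∀ b < p.len, p.dec b = q.dec b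
  le_refl p := ⟨le_rfl, fun _ _ => rfl⟩
  le_trans p q r h h' := ⟨h.1.trans h'.1, fun b hb =>
    (h.2 b hb).trans (h'.2 b (hb.trans_le h.1))⟩
  le_antisymm p q h h' := eq_of_len_eq (h.1.antisymm h'.1) h.2

theorem le_def {p q : DecisionTree F A} :
    p ≤ q ↔ p.len ≤ q.len ∧ ∀ b < p.len, p.dec b = q.dec b := Iff.rfl

theorem lt_iff {p q : DecisionTree F A} :
    p < q ↔ p.len < q.len ∧ ∀ b < p.len, p.dec b = q.dec b := by
  rw [lt_iff_le_and_ne, le_def]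
  constructor
  · rintro ⟨⟨h, h'⟩, hn⟩
    exact ⟨h.lt_of_ne fun he => hn (eq_of_len_eq he h'), h'⟩
  · rintro ⟨h, h'⟩
    exact ⟨⟨h.le, h'⟩, fun he => h.ne (by rw [he])⟩

/-- The initial segment of length `a` of a sequence of decisions. -/
noncomputable def restrict (p : DecisionTree F A) (a : κ.ord.ToType) (h : a ≤ p.len) :
    DecisionTree F A :=
  ⟨(a, cut p.dec a), fun _ => cut_of_le, p.2.2.mono fun x hx b hb => by
    exact (hx b (hb.trans_le h)).trans (iff_of_eq (congrArg (· = true) (cut_of_lt hb).symm))⟩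

/-- The predecessors of a node correspond to the indices smaller than its length. -/
noncomputable def orderIsoIio (p : DecisionTree F A) : Iio p ≃o Iio p.len where
  toFun q := ⟨q.1.len, (lt_iff.1 q.2).1⟩
  invFun a := ⟨p.restrict a.1 a.2.le, lt_iff.2 ⟨a.2, fun _ hb => cut_of_lt hb⟩⟩
  left_inv q := Subtype.ext (eq_of_len_eq rfl fun _ hb =>
    (cut_of_lt hb).trans ((lt_iff.1 q.2).2 _ hb).symm)
  right_inv _ := rfl
  map_rel_iff' {q r} := by
    refine ⟨fun h => ⟨h, fun b hb => ?_⟩, fun h => h.1⟩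
    exact ((lt_iff.1 q.2).2 b hb).trans ((lt_iff.1 r.2).2 b (hb.trans_le h)).symm

theorem isSetTree : IsSetTree (DecisionTree F A) := fun p =>
  (RelIso.toRelEmbedding (orderIsoIio p).toRelIsoLT).isWellOrder

theorem mk_len_eq_lt (hi : κ.IsInaccessible) (a : κ.ord.ToType) :
    #{p : DecisionTree F A | p.len = a} < κ := by
  refine lt_of_le_of_lt ?_ ((mk_range_cut_le a).trans_lt
    (hi.isStrongPrelimit (mk_Iio_toType_lt a)))
  refine Cardinal.mk_le_of_injective
    (f := fun p => ⟨p.1.dec, p.1.dec, funext fun b => ?_⟩) ?_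
  · rcases lt_or_ge b a with hb | hb
    · exact cut_of_lt hb
    · exact (cut_of_le hb).trans (p.1.2.1 b (p.2.le.trans hb)).symm
  · rintro ⟨p, hp⟩ ⟨q, hq⟩ h
    exact Subtype.ext (eq_of_len_eq (hp.trans hq.symm) fun b _ => congrFun (Subtype.ext_iff.1 h) b)

/-- Isomorphic initial segments of a well-order coincide, so all nodes of one level have the same
length `a`, and there are at most `2 ^ #(Iio a) < κ` of those. -/
theorem mk_treeLevel_lt (hi : κ.IsInaccessible) (o : Ordinal.{u}) :
    #(treeLevel (DecisionTree F A) o) < κ := by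
  rcases (treeLevel (DecisionTree F A) o).eq_empty_or_nonempty with h | ⟨p, ⟨e⟩⟩
  · simpa [h] using hi.pos
  refine (Cardinal.mk_le_mk_of_subset ?_).trans_lt (mk_len_eq_lt (F := F) (A := A) hi p.len)
  rintro q ⟨e'⟩
  have i : Iio q.len ≃o Iio p.len := (orderIsoIio q).symm.trans (e'.trans (e.symm.trans
    (orderIsoIio p)))
  have := Ordinal.typein_inj (α := κ.ord.ToType) (· < ·) (a := q.len) (b := p.len)
  refine this.1 ?_
  exact Ordinal.type_eq.2 ⟨i.toRelIsoLT⟩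

/-- Otherwise each of the fewer than `κ` patterns of length `a` is avoided on a set in `F`; by
completeness some `x` avoids them all, including its own pattern. -/
theorem exists_len_eq (hi : κ.IsInaccessible) [F.NeBot] [CardinalInterFilter F κ]
    (a : κ.ord.ToType) : ∃ p : DecisionTree F A, p.len = a := by
  by_contra! hne
  have key : ∀ s ∈ range (fun s : κ.ord.ToType → Bool => cut s a),
      {x | ¬ ∀ b < a, (x ∈ A b ↔ s b = true)} ∈ F := by
    rintro _ ⟨s, rfl⟩
    by_contra hs
    exact hne ⟨(a, cut s a), fun _ => cut_of_le, hs⟩ rfl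
  have := (Filter.cardinal_bInter_mem ((mk_range_cut_le a).trans_lt
    (hi.isStrongPrelimit (mk_Iio_toType_lt a)))).2 key
  obtain ⟨x, hx⟩ := Filter.nonempty_of_mem this
  classical
  refine mem_iInter₂.1 hx _ ⟨fun b => decide (x ∈ A b), rfl⟩ fun b hb => ?_
  simp [cut_of_lt hb]

theorem mk_eq (hi : κ.IsInaccessible) [F.NeBot] [CardinalInterFilter F κ] :
    #(DecisionTree F A) = κ := by
  apply le_antisymm
  · have : (univ : Set (DecisionTree F A)) = ⋃ a, {p | p.len = a} := by ext; simp
    rw [← Cardinal.mk_univ, this]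
    refine (Cardinal.mk_iUnion_le _).trans ?_
    rw [Cardinal.mk_ord_toType]
    exact (mul_le_mul_right (ciSup_le' fun a => (mk_len_eq_lt hi a).le) κ).trans
      (Cardinal.mul_eq_self hi.aleph0_lt.le).le
  · choose f hf using fun a => exists_len_eq (F := F) (A := A) hi a
    refine (Cardinal.mk_ord_toType κ).ge.trans ?_
    exact Cardinal.mk_le_of_injective (f := f) fun a b h => by rw [← hf a, ← hf b, h]

/-- A branch through the decision tree decides the whole sequence of sets. -/
theorem exists_decision (hw : IsWeaklyCompactCardinal κ) (F : Filter X) [F.NeBot]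
    [CardinalInterFilter F κ] (A : κ.ord.ToType → Set X) :
    ∃ y : κ.ord.ToType → Bool, ∀ a, ∃ᶠ x in F, ∀ b < a, (x ∈ A b ↔ y b = true) := by
  obtain ⟨hi, ht⟩ := hw
  obtain ⟨B, hB, hBκ⟩ := ht (DecisionTree F A) isSetTree (mk_eq hi) (mk_treeLevel_lt hi)
  have inj : ∀ p ∈ B, ∀ q ∈ B, p.len ≤ q.len → p ≤ q := by
    intro p hp q hq h
    rcases hB.isChain.total hp hq with h' | h'
    · exact h'
    · exact (eq_of_len_eq (h'.1.antisymm h) h'.2).ge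
  -- Nodes of a chain are determined by their lengths, so a branch of bounded length would have
  -- fewer than `κ` nodes.
  have unb : ∀ a, ∃ p ∈ B, a ≤ p.len := by
    by_contra! ⟨a, ha⟩
    refine (mk_Iio_toType_lt a).not_ge (hBκ.symm.trans_le ?_)
    refine Cardinal.mk_le_of_injective (f := fun p : B => ⟨p.1.len, ha p p.2⟩) ?_
    rintro ⟨p, hp⟩ ⟨q, hq⟩ h
    have h : p.len = q.len := congrArg Subtype.val h
    exact Subtype.ext ((inj p hp q hq h.le).antisymm (inj q hq p hp h.ge))
  have hr := hi.isRegular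
  choose f hfB hf using fun a => unb a
  choose g hg using fun a : κ.ord.ToType => hr.exists_gt a
  -- Coordinate `b` is read off a branch node of length greater than `b`.
  refine ⟨fun b => (f (g b)).dec b, fun a => (f a).2.2.mono fun x hx b hb => ?_⟩
  have hba := hb.trans_le (hf a)
  rw [hx b hba]
  have hbg := (hg b).trans_le (hf (g b))
  have : (f a).dec b = (f (g b)).dec b := by
    rcases le_total (f a).len (f (g b)).len with h | h
    · exact (inj _ (hfB _) _ (hfB _) h).2 b hba
    · exact ((inj _ (hfB _) _ (hfB _) h).2 b hbg).symm
  exact iff_of_eq (congrArg (· = true) this)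

end DecisionTree

/-- If `κ` is weakly compact, then every proper `(<κ)`-complete filter extends to a proper
`(<κ)`-complete filter which measures any given family of at most `κ` many sets. -/
theorem IsWeaklyCompactCardinal.exists_filter (hw : IsWeaklyCompactCardinal κ) (F : Filter X)
    [F.NeBot] [CardinalInterFilter F κ] {𝒜 : Set (Set X)} (h𝒜 : #𝒜 ≤ κ) :
    ∃ G : Filter X, G.NeBot ∧ CardinalInterFilter G κ ∧ G ≤ F ∧ ∀ S ∈ 𝒜, S ∈ G ∨ Sᶜ ∈ G := by
  rcases 𝒜.eq_empty_or_nonempty with rfl | hne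
  · exact ⟨F, ‹_›, ‹_›, le_rfl, by simp⟩
  have hr := hw.1.isRegular
  have : Nonempty 𝒜 := hne.to_subtype
  obtain ⟨A, hA⟩ : ∃ A : κ.ord.ToType → 𝒜, Function.Surjective A := by
    obtain ⟨e⟩ := Cardinal.le_def .. |>.1 (h𝒜.trans (Cardinal.mk_ord_toType κ).ge)
    exact ⟨Function.invFun e, Function.invFun_surjective e.injective⟩
  obtain ⟨y, hy⟩ := DecisionTree.exists_decision hw F (fun a => (A a : Set X))
  have mono : ∀ {S T : Set X} {a b}, a ≤ b →
      {x | ∀ c < a, (x ∈ (A c : Set X) ↔ y c = true)} ∩ S ⊆ T →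
      {x | ∀ c < b, (x ∈ (A c : Set X) ↔ y c = true)} ∩ S ⊆ T :=
    fun hab h x hx => h ⟨fun c hc => hx.1 c (hc.trans_le hab), hx.2⟩
  have key : ∀ 𝒮 : Set (Set X), #𝒮 < κ → (∀ S ∈ 𝒮, ∃ a, ∃ T ∈ F,
      {x | ∀ c < a, (x ∈ (A c : Set X) ↔ y c = true)} ∩ T ⊆ S) →
      ∃ a, ∃ T ∈ F, {x | ∀ c < a, (x ∈ (A c : Set X) ↔ y c = true)} ∩ T ⊆ ⋂₀ 𝒮 := by
    intro 𝒮 h𝒮 h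
    choose f T hT hfT using fun S : 𝒮 => h S S.2
    obtain ⟨a, ha⟩ := hr.exists_forall_lt h𝒮 f
    refine ⟨a, ⋂ S, T S, (Filter.cardinal_iInter_mem h𝒮).2 hT, ?_⟩
    exact fun x hx S hS => mono (ha ⟨S, hS⟩).le (hfT ⟨S, hS⟩) ⟨hx.1, mem_iInter.1 hx.2 _⟩
  -- `G` is generated by `F` and the sets of points following `y` below some `a`; these decrease
  -- with `a`, so regularity gives completeness.
  let G : Filter X :=
    { sets := {S | ∃ a, ∃ T ∈ F, {x | ∀ c < a, (x ∈ (A c : Set X) ↔ y c = true)} ∩ T ⊆ S}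
      univ_sets := by
        obtain ⟨a, -⟩ := hr.exists_forall_lt (ι := PEmpty) (by simpa using hr.pos) (fun a => a.elim)
        exact ⟨a, univ, Filter.univ_mem, subset_univ _⟩
      sets_of_superset := fun ⟨a, T, hT, h⟩ hST => ⟨a, T, hT, h.trans hST⟩
      inter_sets := fun {S S'} hS hS' => by
        rw [← sInter_pair]
        refine key _ (lt_of_lt_of_le ?_ hr.aleph0_le) (by
          rintro _ (rfl | rfl)
          exacts [hS, hS'])
        exact Cardinal.lt_aleph0_iff_set_finite.2 (toFinite _) }
  have hG : ∀ S, S ∈ G ↔ ∃ a, ∃ T ∈ F,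
    {x | ∀ c < a, (x ∈ (A c : Set X) ↔ y c = true)} ∩ T ⊆ S := fun S => Iff.rfl
  refine ⟨G, ⟨fun hb => ?_⟩, ⟨fun 𝒮 h𝒮 h => key 𝒮 h𝒮 h⟩, fun S hS => ?_, fun S hS => ?_⟩
  · obtain ⟨a, T, hT, h⟩ := (hG ∅).1 (hb ▸ Filter.mem_bot)
    obtain ⟨x, hx⟩ := ((hy a).and_eventually hT).exists
    exact h hx
  · obtain ⟨a, -⟩ := (hG univ).1 Filter.univ_mem
    exact (hG S).2 ⟨a, S, hS, inter_subset_right⟩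
  · obtain ⟨b, hb⟩ := hA ⟨S, hS⟩
    obtain ⟨a, ha⟩ := hr.exists_gt b
    have hb : (A b : Set X) = S := by rw [hb]
    cases hyb : y b
    · exact .inr ((hG _).2 ⟨a, univ, Filter.univ_mem, fun x hx => by
        simpa [hyb, hb] using hx.1 b ha⟩)
    · exact .inl ((hG _).2 ⟨a, univ, Filter.univ_mem, fun x hx => by
        simpa [hyb, hb] using hx.1 b ha⟩)

theorem IsWeaklyCompactCardinal.filterExtensionProperty (hw : IsWeaklyCompactCardinal κ) :
    FilterExtensionProperty κ κ :=
  fun _ h𝒜 F _ _ _ => hw.exists_filter F h𝒜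

end DecisionTree

/-! ### Box topologies -/

section Box

variable {κ : Cardinal.{u}} {ι : Type u} {X : ι → Type v} [∀ i, TopologicalSpace (X i)]

theorem BoxProduct.isOpen_box {J : Set ι} (hJ : #J < κ) {O : ∀ i, Set (X i)}
    (hO : ∀ i ∈ J, IsOpen (O i)) : IsOpen {x : BoxProduct κ X | ∀ i ∈ J, x i ∈ O i} := by
  classical
  refine isOpen_generateFrom_of_mem ⟨fun i => if i ∈ J then O i else univ, fun i => ?_, ?_, ?_⟩
  · by_cases h : i ∈ J
    · simpa [h] using hO i h
    · simp [h]
  · refine (Cardinal.mk_le_mk_of_subset fun i hi => ?_).trans_lt hJ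
    by_contra h
    simp [h] at hi
  · ext x
    refine ⟨fun h i _ => ?_, fun h i hi => ?_⟩
    · dsimp only
      split_ifs with hi
      exacts [h i hi, mem_univ _]
    · simpa [hi] using h i trivial

theorem BoxProduct.exists_box_subset (hr : κ.IsRegular) {U : Set (BoxProduct κ X)} (hU : IsOpen U)
    {x : BoxProduct κ X} (hx : x ∈ U) : ∃ J : Set ι, #J < κ ∧ ∃ O : ∀ i, Set (X i),
      (∀ i, IsOpen (O i)) ∧ (∀ i, x i ∈ O i) ∧ ∀ y : BoxProduct κ X, (∀ i ∈ J, y i ∈ O i) → y ∈ U := by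
  induction hU with
  | basic S hS =>
    obtain ⟨O, hO, hJ, rfl⟩ := hS
    refine ⟨_, hJ, O, hO, fun i => hx i trivial, fun y hy i _ => ?_⟩
    by_cases h : O i = univ
    · exact h ▸ mem_univ _
    · exact hy i h
  | univ => exact ⟨∅, by simpa using hr.pos, fun _ => univ, by simp, by simp, fun y _ => mem_univ y⟩
  | inter S T _ _ ihS ihT =>
    obtain ⟨J, hJ, O, hO, hxO, h⟩ := ihS hx.1
    obtain ⟨J', hJ', O', hO', hxO', h'⟩ := ihT hx.2
    exact ⟨J ∪ J', (Cardinal.mk_union_le _ _).trans_lt (Cardinal.add_lt_of_lt hr.aleph0_le hJ hJ'),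
      fun i => O i ∩ O' i, fun i => (hO i).inter (hO' i), fun i => ⟨hxO i, hxO' i⟩,
      fun y hy => ⟨h y fun i hi => (hy i (.inl hi)).1, h' y fun i hi => (hy i (.inr hi)).2⟩⟩
  | sUnion 𝒮 _ ih =>
    obtain ⟨S, hS, hx⟩ := hx
    obtain ⟨J, hJ, O, hO, hxO, h⟩ := ih S hS hx
    exact ⟨J, hJ, O, hO, hxO, fun y hy => ⟨S, hS, h y hy⟩⟩

theorem BoxProduct.continuous_id (hκ : 1 < κ) :
    Continuous (X := BoxProduct κ X) (Y := ∀ i, X i) fun x i => x i := by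
  refine continuous_pi fun i => ⟨fun U hU => ?_⟩
  classical
  have := BoxProduct.isOpen_box (κ := κ) (X := X) (J := {i})
    (O := Function.update (fun _ => univ) i U) (by simpa using hκ) (by simpa using hU)
  simp only [mem_singleton_iff, forall_eq, Function.update_self] at this
  exact this

theorem BoxProduct.continuous_map {Y : ι → Type*} [∀ i, TopologicalSpace (Y i)]
    {f : ∀ i, X i → Y i} (hf : ∀ i, Continuous (f i)) :
    Continuous (X := BoxProduct κ X) (Y := BoxProduct κ Y) fun x i => f i (x i) := by
  refine continuous_generateFrom_iff.2 ?_
  intro S hS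
  obtain ⟨O, hO, hc, rfl⟩ := hS
  convert BoxProduct.isOpen_box (κ := κ) (X := X) hc (O := fun i => f i ⁻¹' O i)
    (fun i _ => (hO i).preimage (hf i)) using 1
  ext x
  refine ⟨fun h i _ => h i trivial, fun h i _ => ?_⟩
  by_cases hi : O i = univ
  · exact hi ▸ mem_univ _
  · exact h i hi

end Box

/-- If `κ` is weakly compact, then `(<κ)`-box products of at most `κ` many `(<κ)`-compact spaces of
weight at most `κ` are `(<κ)`-compact. -/
theorem IsWeaklyCompactCardinal.ltCompact_boxProduct {κ : Cardinal.{u}}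
    (hw : IsWeaklyCompactCardinal κ) {ι : Type u} {X : ι → Type u} [∀ i, TopologicalSpace (X i)]
    (hι : #ι ≤ κ) (hX : ∀ i, LtCompact κ (X i)) (hwt : ∀ i, topWeight (X i) ≤ κ) :
    LtCompact κ (BoxProduct κ X) := by
  have hr := hw.1.isRegular
  intro 𝒰 hU hcov
  by_contra! hno
  choose B hB hBw using fun i => exists_basis_card_eq_topWeight (X i)
  have := neBot_smallCoverFilter hr hno
  have := cardinalInterFilter_smallCoverFilter hr 𝒰
  let 𝒜 : Set (Set (BoxProduct κ X)) := ⋃ i, (fun V => {x | x i ∈ V}) '' B i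
  have h𝒜 : #𝒜 ≤ κ := by
    refine (Cardinal.mk_iUnion_le _).trans ?_
    refine (mul_le_mul' hι (ciSup_le' fun i => Cardinal.mk_image_le.trans
      ((hBw i).trans_le (hwt i)))).trans (Cardinal.mul_eq_self hr.aleph0_le).le
  obtain ⟨G, hG, hGκ, hGF, hm⟩ := hw.exists_filter (smallCoverFilter hr 𝒰) h𝒜
  -- The projection of `G` to `X i` converges to some `z`: otherwise basic sets outside `G` cover `X
  -- i`, fewer than `κ` of them suffice, and their complements in `G` have empty intersection.
  have hpt : ∀ i, ∃ z : X i, ∀ V ∈ B i, z ∈ V → {x : BoxProduct κ X | x i ∈ V} ∈ G := by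
    intro i
    by_contra! h
    choose V hV hz hVG using h
    obtain ⟨J, hJ, hJc⟩ := (hX i).exists_subcover V (fun z => (hB i).isOpen (hV z))
      (fun z => ⟨z, hz z⟩)
    have h1 : ∀ j ∈ J, {x : BoxProduct κ X | x i ∈ V j}ᶜ ∈ G := fun j _ =>
      (hm _ (mem_iUnion.2 ⟨i, mem_image_of_mem _ (hV j)⟩)).resolve_left (hVG j)
    obtain ⟨x, hx⟩ := Filter.nonempty_of_mem ((Filter.cardinal_bInter_mem hJ).2 h1)
    obtain ⟨j, hj, hxj⟩ := hJc (x i)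
    exact mem_iInter₂.1 hx j hj hxj
  choose z hz using hpt
  obtain ⟨U, hU𝒰, hzU⟩ := (hcov ▸ mem_univ z : z ∈ ⋃₀ 𝒰)
  obtain ⟨J, hJ, O, hO, hzO, hsub⟩ := BoxProduct.exists_box_subset hr (hU U hU𝒰) hzU
  have h1 : ∀ i ∈ J, {x : BoxProduct κ X | x i ∈ O i} ∈ G := by
    intro i _
    obtain ⟨V, hV, hzV, hVO⟩ := (hB i).exists_subset_of_mem_open (hzO i) (hO i)
    exact Filter.mem_of_superset (hz i V hV hzV) fun x hx => hVO hx
  have h2 : U ∈ G := Filter.mem_of_superset ((Filter.cardinal_bInter_mem hJ).2 h1)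
    fun x hx => hsub x fun i hi => mem_iInter₂.1 hx i hi
  obtain ⟨x, hx, hx'⟩ := Filter.nonempty_of_mem
    (Filter.inter_mem h2 (hGF (compl_mem_smallCoverFilter hr hU𝒰)))
  exact hx' hx

/-! ### The space `2 ^ κ`: strong limit -/

section Cantor

variable {κ : Cardinal.{u}}

theorem isOpen_of_dependsOn {J : Set κ.ord.ToType} (hJ : #J < κ)
    {S : Set (BoxProduct κ (fun _ : κ.ord.ToType => Bool))}
    (hS : ∀ x ∈ S, ∀ y, (∀ i ∈ J, y i = x i) → y ∈ S) : IsOpen S := by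
  refine isOpen_iff_forall_mem_open.2 fun x hx => ⟨{y | ∀ i ∈ J, y i ∈ ({x i} : Set Bool)},
    fun y hy => hS x hx y hy, BoxProduct.isOpen_box hJ fun _ _ => isOpen_discrete _, ?_⟩
  exact fun i _ => rfl

theorem exists_cylinder_subset (hr : κ.IsRegular)
    {U : Set (BoxProduct κ (fun _ : κ.ord.ToType => Bool))} (hU : IsOpen U)
    {x : BoxProduct κ (fun _ : κ.ord.ToType => Bool)} (hx : x ∈ U) :
    ∃ a, ∀ y : BoxProduct κ (fun _ : κ.ord.ToType => Bool), (∀ b < a, y b = x b) → y ∈ U := by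
  obtain ⟨J, hJ, O, -, hxO, h⟩ := BoxProduct.exists_box_subset hr hU hx
  obtain ⟨a, ha⟩ := hr.exists_forall_mem_lt hJ
  exact ⟨a, fun y hy => h y fun i hi => by rw [hy i (ha i hi)]; exact hxO i⟩

/-- If `2 ^ κ` is `(<κ)`-compact in the `(<κ)`-box topology, then `κ` is a strong limit. -/
theorem isStrongPrelimit_of_ltCompact
    (h : LtCompact κ (BoxProduct κ (fun _ : κ.ord.ToType => Bool))) : κ.IsStrongPrelimit := by
  intro l hl
  obtain ⟨J, rfl⟩ : ∃ J : Set κ.ord.ToType, #J = l :=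
    Cardinal.le_mk_iff_exists_set.1 (hl.le.trans (Cardinal.mk_ord_toType κ).ge)
  -- These cylinders are nonempty and pairwise disjoint, so no proper subfamily covers.
  obtain ⟨I, hI, hc⟩ := h.exists_subcover (ι := J → Bool) (fun s => {x | ∀ i : J, x i = s i})
    (fun s => isOpen_of_dependsOn hl fun x hx y hy i => (hy i i.2).trans (hx i))
    (fun x => ⟨fun i => x i, fun _ => rfl⟩)
  have : I = univ := by
    refine eq_univ_of_forall fun s => ?_
    classical
    obtain ⟨t, ht, hst⟩ := hc (fun i => if h : i ∈ J then s ⟨i, h⟩ else false)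
    convert ht
    funext i
    simpa using hst i
  simpa [this] using hI

end Cantor

/-! ### Heights in trees and the tree property -/

section Height

variable {T : Type u} [PartialOrder T]

/-- The height of an element of a tree: the order type of the set of its predecessors. -/
noncomputable def treeHeight (hT : IsSetTree T) (x : T) : Ordinal.{u} :=
  have := hT x
  Ordinal.type ((· < ·) : Iio x → Iio x → Prop)

theorem mem_treeLevel_iff (hT : IsSetTree T) {x : T} {o : Ordinal.{u}} :
    x ∈ treeLevel T o ↔ treeHeight hT x = o := by
  have := hT x
  conv_rhs => rw [treeHeight, ← Ordinal.type_toType o, Ordinal.type_eq]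
  constructor
  · rintro ⟨e⟩
    exact ⟨(e.trans Ordinal.ToType.mk).toRelIsoLT⟩
  · rintro ⟨e⟩
    exact ⟨(OrderIso.ofRelIsoLT e).trans Ordinal.ToType.mk.symm⟩

theorem treeHeight_coe (hT : IsSetTree T) {x : T} (y : Iio x) :
    have := hT x
    treeHeight hT y = Ordinal.typein ((· < ·) : Iio x → Iio x → Prop) y := by
  intro _
  have := hT y
  rw [← Ordinal.type_subrel, treeHeight, Ordinal.type_eq]
  exact ⟨⟨⟨fun z => ⟨⟨z.1, z.2.trans y.2⟩, z.2⟩, fun z => ⟨z.1.1, z.2⟩, fun _ => rfl,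
    fun _ => rfl⟩, Iff.rfl⟩⟩

theorem treeHeight_lt (hT : IsSetTree T) {x y : T} (h : y < x) :
    treeHeight hT y < treeHeight hT x := by
  have := hT x
  rw [treeHeight_coe hT (⟨y, h⟩ : Iio x)]
  exact Ordinal.typein_lt_type _ _

theorem exists_lt_treeHeight_eq (hT : IsSetTree T) {x : T} {o : Ordinal.{u}}
    (h : o < treeHeight hT x) : ∃ y < x, treeHeight hT y = o := by
  have := hT x
  refine ⟨(Ordinal.enum ((· < ·) : Iio x → Iio x → Prop) ⟨o, h⟩).1,
    (Ordinal.enum ((· < ·) : Iio x → Iio x → Prop) ⟨o, h⟩).2, ?_⟩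
  rw [treeHeight_coe]
  exact Ordinal.typein_enum _ _

theorem IsSetTree.le_total (hT : IsSetTree T) {x y z : T} (hx : x ≤ z) (hy : y ≤ z) :
    x ≤ y ∨ y ≤ x := by
  have := hT z
  rcases hx.eq_or_lt with rfl | hx
  · exact .inr hy
  rcases hy.eq_or_lt with rfl | hy
  · exact .inl hx.le
  rcases trichotomous_of ((· < ·) : Iio z → Iio z → Prop) ⟨x, hx⟩ ⟨y, hy⟩ with h | h | h
  · exact .inl (le_of_lt (show x < y from h))
  · exact .inl (Subtype.ext_iff.1 h).le
  · exact .inr (le_of_lt (show y < x from h))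

theorem IsSetTree.le_of_treeHeight_le (hT : IsSetTree T) {x y z : T} (hx : x ≤ z) (hy : y ≤ z)
    (h : treeHeight hT x ≤ treeHeight hT y) : x ≤ y := by
  rcases hT.le_total hx hy with h' | h'
  · exact h'
  · rcases h'.eq_or_lt with rfl | h'
    · exact le_rfl
    · exact absurd h (treeHeight_lt hT h').not_ge

variable {κ : Cardinal.{u}}

theorem mk_treeHeight_le_lt (hr : κ.IsRegular) (hT : IsSetTree T)
    (hl : ∀ o : Ordinal.{u}, #(treeLevel T o) < κ) {o : Ordinal.{u}} (ho : o < κ.ord) :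
    #{x | treeHeight hT x ≤ o} < κ := by
  have ho' : Order.succ o < κ.ord := (Cardinal.isSuccLimit_ord hr.aleph0_le).succ_lt ho
  have : {x | treeHeight hT x ≤ o} ⊆
      ⋃ a : (Order.succ o).ToType, treeLevel T (Ordinal.ToType.toOrd a).1 := by
    intro x hx
    refine mem_iUnion.2 ⟨Ordinal.ToType.mk ⟨treeHeight hT x, mem_Iio.2 (Order.lt_succ_iff.2 hx)⟩, ?_⟩
    rw [mem_treeLevel_iff hT]
    simp
  refine (Cardinal.mk_le_mk_of_subset this).trans_lt
    ((Cardinal.card_iUnion_lt_iff_forall_of_isRegular hr ?_).2 fun a => hl _)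
  rw [Cardinal.mk_toType]
  exact Cardinal.lt_ord.1 ho'

/-- Heights occurring in a tree are closed downwards, so a missing `o` would bound them all and
leave fewer than `κ` nodes. -/
theorem exists_treeHeight_eq (hr : κ.IsRegular) (hT : IsSetTree T) (hTκ : κ ≤ #T)
    (hl : ∀ o : Ordinal.{u}, #(treeLevel T o) < κ) {o : Ordinal.{u}} (ho : o < κ.ord) :
    ∃ x, treeHeight hT x = o := by
  by_contra! h
  refine (mk_treeHeight_le_lt hr hT hl ho).not_ge (hTκ.trans ?_)
  rw [← Cardinal.mk_univ]
  refine Cardinal.mk_le_mk_of_subset fun x _ => ?_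
  by_contra hx
  obtain ⟨y, -, hy⟩ := exists_lt_treeHeight_eq hT (not_le.1 hx)
  exact h y hy

/-- If `2 ^ κ` is `(<κ)`-compact in the `(<κ)`-box topology, then `κ` has the tree property. -/
theorem treeProperty_of_ltCompact (hr : κ.IsRegular)
    (h : LtCompact κ (BoxProduct κ (fun _ : κ.ord.ToType => Bool))) : TreeProperty κ := by
  intro T _ hT hTκ hl
  obtain ⟨e⟩ : Nonempty (T ≃ κ.ord.ToType) :=
    Cardinal.eq.1 (hTκ.trans (Cardinal.mk_ord_toType κ).symm)
  -- `C a`: up to height `a`, `x` codes the elements `≤ t` for some `t` of height `a`. Only fewer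
  -- than `κ` coordinates matter.
  let C : κ.ord.ToType → Set (BoxProduct κ (fun _ : κ.ord.ToType => Bool)) := fun a =>
    {x | ∃ t, treeHeight hT t = (Ordinal.ToType.toOrd a).1 ∧
      ∀ s, treeHeight hT s ≤ (Ordinal.ToType.toOrd a).1 → (x (e s) = true ↔ s ≤ t)}
  have hlt : ∀ a : κ.ord.ToType, (Ordinal.ToType.toOrd a).1 < κ.ord := fun a =>
    (Ordinal.ToType.toOrd a).2
  have hopen : ∀ a, IsOpen (C a)ᶜ := by
    intro a
    refine isOpen_of_dependsOn (J := e '' {s | treeHeight hT s ≤ (Ordinal.ToType.toOrd a).1})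
      (Cardinal.mk_image_le.trans_lt (mk_treeHeight_le_lt hr hT hl (hlt a))) ?_
    rintro x hx y hy ⟨t, ht, hyt⟩
    exact hx ⟨t, ht, fun s hs => by rw [← hyt s hs, hy _ (mem_image_of_mem e hs)]⟩
  obtain ⟨x, hx⟩ : ∃ x, ∀ a, x ∈ C a := by
    by_contra! hne
    obtain ⟨J, hJ, hJc⟩ := h.exists_subcover (fun a => (C a)ᶜ) hopen hne
    obtain ⟨a, ha⟩ := hr.exists_forall_mem_lt hJ
    obtain ⟨t, ht⟩ := exists_treeHeight_eq hr hT hTκ.ge hl (hlt a)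
    classical
    -- The elements below a node `t` of height `a` satisfy every `C b` with `b < a`, witnessed by
    -- the predecessor of `t` at height `b`.
    obtain ⟨b, hb, hxb⟩ := hJc (fun i => decide (e.symm i ≤ t))
    have hba : (Ordinal.ToType.toOrd b).1 < (Ordinal.ToType.toOrd a).1 :=
      Subtype.coe_lt_coe.2 (OrderIso.lt_iff_lt _ |>.2 (ha b hb))
    obtain ⟨t', htt', ht'⟩ := exists_lt_treeHeight_eq hT (hba.trans_le ht.ge)
    refine hxb ⟨t', ht', fun s hs => ?_⟩
    simp only [Equiv.symm_apply_apply, decide_eq_true_eq]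
    exact ⟨fun hst => hT.le_of_treeHeight_le hst htt'.le (hs.trans ht'.ge),
      fun hst => hst.trans htt'.le⟩
  choose t ht htx using hx
  let b : Set T := {s | treeHeight hT s < κ.ord ∧ x (e s) = true}
  have hb : IsChain (· ≤ ·) b := by
    rintro s ⟨hs, hxs⟩ s' ⟨hs', hxs'⟩ -
    let a : κ.ord.ToType := Ordinal.ToType.mk ⟨max (treeHeight hT s) (treeHeight hT s'),
      max_lt hs hs'⟩
    have ha : (Ordinal.ToType.toOrd a).1 = max (treeHeight hT s) (treeHeight hT s') := by simp [a]
    exact hT.le_total ((htx a s (ha.symm ▸ le_max_left _ _)).1 hxs)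
      ((htx a s' (ha.symm ▸ le_max_right _ _)).1 hxs')
  obtain ⟨M, hM, hbM⟩ := hb.exists_maxChain
  refine ⟨M, hM, le_antisymm ((Cardinal.mk_set_le M).trans hTκ.le) ?_⟩
  refine le_trans ?_ (Cardinal.mk_le_mk_of_subset hbM)
  have htb : ∀ a, t a ∈ b := fun a =>
    ⟨(ht a).trans_lt (hlt a), (htx a _ (ht a).le).2 le_rfl⟩
  refine (Cardinal.mk_ord_toType κ).ge.trans
    (Cardinal.mk_le_of_injective (f := fun a => (⟨t a, htb a⟩ : b)) fun a a' haa => ?_)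
  have : t a = t a' := congrArg Subtype.val haa
  have := (ht a).symm.trans ((congrArg _ this).trans (ht a'))
  exact Ordinal.ToType.mk.symm.injective (Subtype.ext this)

end Height

theorem isWeaklyCompactCardinal_of_ltCompact {κ : Cardinal.{u}} (hr : κ.IsRegular) (hω : ℵ₀ < κ)
    (h : LtCompact κ (BoxProduct κ (fun _ : κ.ord.ToType => Bool))) : IsWeaklyCompactCardinal κ :=
  ⟨⟨hω, hr.le_cof_ord, isStrongPrelimit_of_ltCompact h⟩, treeProperty_of_ltCompact hr h⟩

/-- If `κ` has the `κ`-filter extension property, then `2 ^ κ` is `(<κ)`-compact in the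
`(<κ)`-box topology. -/
theorem ltCompact_of_filterExtensionProperty {κ : Cardinal.{u}} (hκ : κ ^< κ = κ) (hω : ℵ₀ < κ)
    (h : FilterExtensionProperty κ κ) :
    LtCompact κ (BoxProduct κ (fun _ : κ.ord.ToType => Bool)) := by
  have hr := isRegular_of_powerlt_eq hκ hω
  intro 𝒰 hU hcov
  by_contra! hno
  let cyl : (Σ a : κ.ord.ToType, (Iio a → Bool)) → Set (TwoPow κ) :=
    fun p => {y | ∀ b : Iio p.1, y b = p.2 b}
  -- Refining the cover to cylinders leaves at most `κ` sets, hence at most `κ` generators for the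
  -- filter.
  let 𝒲 : Set (Set (TwoPow κ)) := {S | S ∈ range cyl ∧ ∃ U ∈ 𝒰, S ⊆ U}
  have h𝒲 : #𝒲 ≤ κ :=
    (Cardinal.mk_le_mk_of_subset (t := range cyl) fun _ hS => hS.1).trans (Cardinal.mk_range_le.trans
      (mk_sigma_Iio_bool_le hκ hω))
  have hno' : ∀ 𝒱 ⊆ 𝒲, #𝒱 < κ → ⋃₀ 𝒱 ≠ univ := by
    intro 𝒱 h𝒱 hc hu
    choose! g hg𝒰 hg using fun S (hS : S ∈ 𝒱) => (h𝒱 hS).2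
    refine hno (g '' 𝒱) (image_subset_iff.2 hg𝒰) (Cardinal.mk_image_le.trans_lt hc) ?_
    refine eq_univ_of_forall fun x => ?_
    obtain ⟨S, hS, hx⟩ := (hu ▸ mem_univ x : x ∈ ⋃₀ 𝒱)
    exact ⟨g S, mem_image_of_mem g hS, hg S hS hx⟩
  have hgen : smallCoverFilter hr 𝒲 = Filter.generate
      (range fun 𝒱 : {s : Set 𝒲 | #s < κ} => (⋃ V ∈ 𝒱.1, (V : Set (TwoPow κ)))ᶜ) := by
    apply le_antisymm
    · rw [Filter.le_generate_iff]
      rintro _ ⟨⟨𝒱, h𝒱⟩, rfl⟩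
      refine ⟨(↑) '' 𝒱, by simp, Cardinal.mk_image_le.trans_lt h𝒱, ?_⟩
      rw [compl_compl, sUnion_image]
    · rintro S ⟨𝒱, h𝒱, hc, hS⟩
      refine Filter.mem_of_superset (Filter.GenerateSets.basic ⟨⟨(↑) ⁻¹' 𝒱, ?_⟩, rfl⟩) ?_
      · exact (Cardinal.mk_preimage_of_injective _ _ Subtype.val_injective).trans_lt hc
      · refine compl_subset_comm.1 (hS.trans ?_)
        rintro x ⟨V, hV, hx⟩
        exact mem_iUnion₂.2 ⟨⟨V, h𝒱 hV⟩, hV, hx⟩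
  obtain ⟨G, hG, hGκ, hGF, hm⟩ := h (range fun i => {x : TwoPow κ | x i = true})
    (Cardinal.mk_range_le.trans (Cardinal.mk_ord_toType κ).le) (smallCoverFilter hr 𝒲)
    (neBot_smallCoverFilter hr hno') (cardinalInterFilter_smallCoverFilter hr 𝒲)
    ⟨_, Cardinal.mk_range_le.trans (mk_small_subsets_le hκ hω h𝒲), hgen⟩
  classical
  let x : TwoPow κ := fun i => decide ({y : TwoPow κ | y i = true} ∈ G)
  have hx : ∀ i, {y : TwoPow κ | y i = x i} ∈ G := by
    intro i
    by_cases hi : {y : TwoPow κ | y i = true} ∈ G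
    · simp [x, hi]
    · have := (hm _ (mem_range_self i)).resolve_left hi
      have e : {y : TwoPow κ | y i = x i} = {y : TwoPow κ | y i = true}ᶜ := by
        ext y
        simp [x, hi]
      rwa [e]
  obtain ⟨U, hU𝒰, hxU⟩ := (hcov ▸ mem_univ x : x ∈ ⋃₀ 𝒰)
  obtain ⟨a, ha⟩ := exists_cylinder_subset hr (hU U hU𝒰) hxU
  have hC : cyl ⟨a, fun b => x b⟩ ∈ 𝒲 := ⟨mem_range_self _, U, hU𝒰, fun y hy =>
    ha y fun b hb => hy ⟨b, hb⟩⟩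
  have hCG : cyl ⟨a, fun b => x b⟩ ∈ G := by
    refine Filter.mem_of_superset ((Filter.cardinal_bInter_mem (mk_Iio_toType_lt a)).2
      fun b _ => hx b) fun y hy b => ?_
    exact mem_iInter₂.1 hy b.1 b.2
  obtain ⟨y, hy, hy'⟩ := Filter.nonempty_of_mem
    (Filter.inter_mem hCG (hGF (compl_mem_smallCoverFilter hr hC)))
  exact hy' hy

/-! ### Sorgenfrey topologies on linear orders -/

section Sorgenfrey

/-- A linear order with the topology whose basic open sets are the half-open intervals `[a, b)`
and the rays `[a, ∞)`. -/
def Sorgenfrey (L : Type u) : Type u := L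

variable {L : Type u} [LinearOrder L]

noncomputable instance : LinearOrder (Sorgenfrey L) := inferInstanceAs (LinearOrder L)

/-- The half-open intervals and closed rays to the right. -/
def sorgenfreyBasis (L : Type u) [LinearOrder L] : Set (Set L) :=
  range (fun p : L × L => Ico p.1 p.2) ∪ range Ici

instance : TopologicalSpace (Sorgenfrey L) := generateFrom (sorgenfreyBasis L)

namespace Sorgenfrey

theorem isTopologicalBasis :
    IsTopologicalBasis (insert univ (sorgenfreyBasis (Sorgenfrey L))) := by
  refine isTopologicalBasis_of_subbasis_of_inter rfl ?_
  rintro _ (⟨⟨a, b⟩, rfl⟩ | ⟨a, rfl⟩) _ (⟨⟨c, d⟩, rfl⟩ | ⟨c, rfl⟩)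
  · exact .inl ⟨(a ⊔ c, b ⊓ d), Ico_inter_Ico.symm⟩
  · exact .inl ⟨(a ⊔ c, b), by ext; simp [and_assoc]⟩
  · exact .inl ⟨(a ⊔ c, d), by ext; simp; tauto⟩
  · exact .inr ⟨a ⊔ c, Ici_inter_Ici.symm⟩

theorem isOpen_Ici (a : Sorgenfrey L) : IsOpen (Ici a) :=
  isOpen_generateFrom_of_mem (.inr ⟨a, rfl⟩)

theorem isOpen_Ico (a b : Sorgenfrey L) : IsOpen (Ico a b) :=
  isOpen_generateFrom_of_mem (.inl ⟨(a, b), rfl⟩)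

theorem isOpen_Iio (b : Sorgenfrey L) : IsOpen (Iio b) := by
  have : Iio b = ⋃ a, Ico a b := by
    ext x
    simp only [mem_Iio, mem_iUnion, mem_Ico]
    exact ⟨fun h => ⟨x, le_rfl, h⟩, fun ⟨_, h⟩ => h.2⟩
  rw [this]
  exact isOpen_iUnion fun a => isOpen_Ico a b

instance : GOSpace (Sorgenfrey L) where
  t2 := by
    have key : ∀ x y : Sorgenfrey L, x < y →
        ∃ U V : Set (Sorgenfrey L), IsOpen U ∧ IsOpen V ∧ x ∈ U ∧ y ∈ V ∧ Disjoint U V :=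
      fun x y h => ⟨Iio y, Ici y, isOpen_Iio y, isOpen_Ici y, h, le_rfl,
        disjoint_left.2 fun z hz hz' => (not_lt.2 hz') hz⟩
    intro x y hxy
    rcases hxy.lt_or_gt with h | h
    · exact key x y h
    · obtain ⟨U, V, hU, hV, hy, hx, hd⟩ := key y x h
      exact ⟨V, U, hV, hU, hx, hy, hd.symm⟩
  exists_convex_basis := by
    refine ⟨_, isTopologicalBasis, ?_⟩
    rintro _ (rfl | ⟨p, rfl⟩ | ⟨a, rfl⟩)
    exacts [ordConnected_univ, ordConnected_Ico, ordConnected_Ici]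

variable {κ : Cardinal.{u}}

theorem topWeight_le (hω : ℵ₀ ≤ κ) (hL : #L ≤ κ) : topWeight (Sorgenfrey L) ≤ κ := by
  refine (_root_.topWeight_le isTopologicalBasis).trans (Cardinal.mk_insert_le.trans ?_)
  refine Cardinal.add_le_of_le hω ((Cardinal.mk_union_le _ _).trans
    (Cardinal.add_le_of_le hω (Cardinal.mk_range_le.trans ?_) (Cardinal.mk_range_le.trans hL)))
    (Cardinal.one_le_aleph0.trans hω)
  rw [← Cardinal.mul_def]
  exact (mul_le_mul' hL hL).trans (Cardinal.mul_eq_self hω).le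

/-- A complete linear order in which all cofinalities are less than `κ` is `(<κ)`-compact in the
Sorgenfrey topology. -/
theorem ltCompact (hr : κ.IsRegular) (hsup : ∀ A : Set L, ∃ l, IsLUB A l)
    (hcof : ∀ S : Set L, ∃ C ⊆ S, #C < κ ∧ ∀ s ∈ S, ∃ c ∈ C, s ≤ c) :
    LtCompact κ (Sorgenfrey L) := by
  refine ltCompact_of_forall fun ι U hU hc => ?_
  have hins : ∀ {J : Set ι} (i : ι), #J < κ → #(insert i J : Set ι) < κ := fun i hJ =>
    Cardinal.mk_insert_le.trans_lt (Cardinal.add_lt_of_lt hr.aleph0_le hJ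
      (Cardinal.one_lt_aleph0.trans_le hr.aleph0_le))
  -- Points up to which fewer than `κ` cover members suffice. The supremum `l` belongs to `S` by
  -- small cofinality; if a neighbourhood `[a, b)` of `l` sits in one member, then `b ∈ S`, beyond
  -- `l`.
  let S : Set (Sorgenfrey L) := {x | ∃ J : Set ι, #J < κ ∧ ∀ y ≤ x, ∃ i ∈ J, y ∈ U i}
  obtain ⟨l, hl⟩ : ∃ l, IsLUB S l := hsup S
  obtain ⟨C, hCS, hC, hcof⟩ : ∃ C ⊆ S, #C < κ ∧ ∀ s ∈ S, ∃ c ∈ C, s ≤ c := hcof S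
  obtain ⟨i, hi⟩ := hc l
  have hlS : l ∈ S := by
    choose! J hJ hJc using (fun c hc => hCS hc :
      ∀ c ∈ C, ∃ J : Set ι, #J < κ ∧ ∀ y ≤ c, ∃ i ∈ J, y ∈ U i)
    refine ⟨insert i (⋃ c ∈ C, J c), hins i (hr.mk_biUnion_lt hC hJ), fun y hy => ?_⟩
    rcases hy.eq_or_lt with rfl | hy
    · exact ⟨i, mem_insert _ _, hi⟩
    · obtain ⟨s, hs, hys⟩ := (lt_isLUB_iff hl).1 hy
      obtain ⟨c, hc, hsc⟩ := hcof s hs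
      obtain ⟨j, hj, hyj⟩ := hJc c hc y (hys.le.trans hsc)
      exact ⟨j, mem_insert_of_mem _ (mem_biUnion hc hj), hyj⟩
  obtain ⟨J, hJ, hJc⟩ := hlS
  by_cases hray : Ici l ⊆ U i
  · refine ⟨insert i J, hins i hJ, fun y => ?_⟩
    rcases le_total y l with hy | hy
    · obtain ⟨j, hj, hyj⟩ := hJc y hy
      exact ⟨j, mem_insert_of_mem _ hj, hyj⟩
    · exact ⟨i, mem_insert _ _, hray hy⟩
  · obtain ⟨V, hV, hlV, hVU⟩ := isTopologicalBasis.exists_subset_of_mem_open hi (hU i)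
    rcases hV with rfl | ⟨⟨a, b⟩, rfl⟩ | ⟨a, rfl⟩
    · exact absurd ((subset_univ _).trans hVU) hray
    · obtain ⟨j, hj⟩ := hc b
      refine absurd (hl.1 ⟨insert j (insert i J), hins j (hins i hJ), fun y hy => ?_⟩ : b ≤ l)
        (not_le.2 hlV.2)
      rcases hy.eq_or_lt with rfl | hy
      · exact ⟨j, mem_insert _ _, hj⟩
      rcases le_total y l with hyl | hyl
      · obtain ⟨k, hk, hyk⟩ := hJc y hyl
        exact ⟨k, mem_insert_of_mem _ (mem_insert_of_mem _ hk), hyk⟩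
      · exact ⟨i, mem_insert_of_mem _ (mem_insert _ _), hVU ⟨hlV.1.trans hyl, hy⟩⟩
    · exact absurd ((Ici_subset_Ici.2 hlV).trans hVU) hray

/-- The product of the two Sorgenfrey topologies on a linear order contains a closed discrete copy
of it. -/
theorem mk_lt_of_ltCompact_prod (h : LtCompact κ (Sorgenfrey L × Sorgenfrey Lᵒᵈ)) : #L < κ := by
  let up : L → Sorgenfrey L := id
  let down : L → Sorgenfrey Lᵒᵈ := OrderDual.toDual
  have hdiag : IsOpen {p : Sorgenfrey L × Sorgenfrey Lᵒᵈ | ∀ z, p ≠ (up z, down z)} := by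
    have aux : ∀ (x y : L), x ≠ y → ∃ (U : Set (Sorgenfrey L)) (V : Set (Sorgenfrey Lᵒᵈ)),
        IsOpen U ∧ IsOpen V ∧ up x ∈ U ∧ down y ∈ V ∧ ∀ z, up z ∈ U → down z ∉ V := by
      intro x y hxy
      rcases hxy.lt_or_gt with h | h
      -- If there is no point between, `z < y` and `x < z` already exclude each other.
      · by_cases hw : ∃ w, x < w ∧ w < y
        · obtain ⟨w, hxw, hwy⟩ := hw
          exact ⟨Iio (up w), Iio (down w), isOpen_Iio _, isOpen_Iio _, hxw, hwy,
            fun z (hz : z < w) (hz' : w < z) => lt_asymm hz hz'⟩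
        · exact ⟨Iio (up y), Iio (down x), isOpen_Iio _, isOpen_Iio _, h, h,
            fun z (hz : z < y) (hz' : x < z) => hw ⟨z, hz', hz⟩⟩
      · exact ⟨Ici (up x), Ici (down y), isOpen_Ici _, isOpen_Ici _, mem_Ici.2 le_rfl,
          mem_Ici.2 le_rfl, fun z (hz : x ≤ z) (hz' : z ≤ y) => (hz.trans hz').not_gt h⟩
    refine isOpen_iff_forall_mem_open.2 ?_
    rintro ⟨x, y⟩ hxy
    obtain ⟨U, V, hU, hV, hx, hy, hUV⟩ := aux x (OrderDual.ofDual (α := L) y) (by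
      rintro rfl
      exact hxy _ rfl)
    refine ⟨U ×ˢ V, ?_, hU.prod hV, hx, hy⟩
    rintro _ ⟨hpU, hpV⟩ z rfl
    exact hUV z hpU hpV
  obtain ⟨J, hJ, hJc⟩ := h.exists_subcover
    (fun o : Option L => o.elim {p : Sorgenfrey L × Sorgenfrey Lᵒᵈ | ∀ z, p ≠ (up z, down z)}
      -- The second ray is reversed, so this box meets the diagonal only at `l`.
      fun l => Ici (up l) ×ˢ Ici (down l))
    (by rintro (_ | l) <;> [exact hdiag; exact (isOpen_Ici _).prod (isOpen_Ici _)])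
    (by
      intro p
      by_cases hp : ∀ z, p ≠ (up z, down z)
      · exact ⟨none, hp⟩
      · push Not at hp
        obtain ⟨z, rfl⟩ := hp
        exact ⟨some z, mem_Ici.2 le_rfl, mem_Ici.2 le_rfl⟩)
  refine lt_of_le_of_lt (Cardinal.mk_le_of_injective (f := fun l => (⟨some l, ?_⟩ : J)) ?_) hJ
  · obtain ⟨_ | l', hl', hp⟩ := hJc (up l, down l)
    · exact absurd rfl (hp l)
    · have h1 : l' ≤ l := hp.1
      have h2 : l ≤ l' := hp.2
      rwa [h1.antisymm h2] at hl'
  · intro a b hab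
    simpa using hab

end Sorgenfrey

end Sorgenfrey

/-! ### The lexicographic order on 0-1 sequences and its leaves -/

section Lex

variable {I : Type u} [LinearOrder I] [WellFoundedLT I]

/-- The lexicographic order on sequences of zeros and ones is complete. -/
theorem exists_isLUB_lex_bool (A : Set (Lex (I → Bool))) : ∃ y, IsLUB A y := by
  classical
  -- The supremum by recursion: put 1 at `b` exactly when some member of `A` agrees with `y` below
  -- `b` and has 1 there.
  let y : Lex (I → Bool) := toLex (WellFoundedLT.fix (motive := fun _ : I => Bool) fun b f =>
    decide (∃ s ∈ A, (∀ c, ∀ h : c < b, s c = f c h) ∧ s b = true))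
  have hy : ∀ b, y b = true ↔ ∃ s ∈ A, (∀ c < b, s c = y c) ∧ s b = true := by
    intro b
    have : y b = decide (∃ s ∈ A, (∀ c < b, s c = y c) ∧ s b = true) :=
      WellFoundedLT.fix_eq (motive := fun _ : I => Bool) _ b
    rw [this, decide_eq_true_iff]
  refine ⟨y, fun s hs => ?_, fun z hz => ?_⟩
  · by_contra hlt
    obtain ⟨b, hb, hyb⟩ := not_le.1 hlt
    have hyb : y b < s b := hyb
    rw [Bool.lt_iff] at hyb
    have := (hy b).2 ⟨s, hs, fun c hc => (hb c hc).symm, hyb.2⟩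
    simp [this] at hyb
  · by_contra hlt
    obtain ⟨b, hb, hyb⟩ := not_le.1 hlt
    have hyb : z b < y b := hyb
    rw [Bool.lt_iff] at hyb
    obtain ⟨s, hs, hsy, hsb⟩ := (hy b).1 hyb.2
    refine (hz hs).not_gt ⟨b, fun c hc => (hb c hc).trans (hsy c hc).symm, ?_⟩
    exact Bool.lt_iff.2 ⟨hyb.1, hsb⟩

end Lex

section EventuallyConstant

variable {κ : Cardinal.{u}}

/-- A family of sequences which is `(<κ)`-directed, with the coordinates eventually moving in one
direction only, converges in the `(<κ)`-box topology. -/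
theorem exists_limit_of_directed {S : Set (κ.ord.ToType → Bool)}
    (r : (κ.ord.ToType → Bool) → (κ.ord.ToType → Bool) → Prop) [IsTrans _ r] (c : Bool)
    (hc : ∀ s t b, r s t → (∀ i < b, s i = t i) → s b = c → t b = c)
    (hdir : ∀ C ⊆ S, #C < κ → ∃ u ∈ S, ∀ s ∈ C, r s u) :
    ∃ y : κ.ord.ToType → Bool, ∀ a, ∃ s ∈ S, ∀ t ∈ S, r s t → ∀ b < a, t b = y b := by
  have key : ∀ b, ∃ s ∈ S, ∃ v, ∀ t ∈ S, r s t → t b = v := by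
    intro b
    induction b using WellFoundedLT.induction with
    | ind b ih =>
      choose! f hf v hv using ih
      obtain ⟨w, hw, hfw⟩ := hdir (f '' Iio b) (image_subset_iff.2 fun i hi => hf i hi)
        (Cardinal.mk_image_le.trans_lt (mk_Iio_toType_lt b))
      have hwt : ∀ t ∈ S, r w t → ∀ i < b, t i = v i := fun t ht hwt i hi =>
        hv i hi t ht (_root_.trans (hfw _ (mem_image_of_mem f hi)) hwt)
      -- Beyond `w` the coordinates below `b` are frozen, so once coordinate `b` takes the value `c`
      -- it keeps it.
      by_cases h : ∃ s ∈ S, r w s ∧ s b = c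
      · obtain ⟨s, hs, hws, hsb⟩ := h
        exact ⟨s, hs, c, fun t ht hst => hc s t b hst (fun i hi => (hwt s hs hws i hi).trans
          (hwt t ht (_root_.trans hws hst) i hi).symm) hsb⟩
      · push Not at h
        exact ⟨w, hw, !c, fun t ht hwt => Bool.eq_not.2 (h t ht hwt)⟩
  choose f hf y hy using key
  refine ⟨y, fun a => ?_⟩
  obtain ⟨w, hw, hfw⟩ := hdir (f '' Iio a) (image_subset_iff.2 fun i _ => hf i)
    (Cardinal.mk_image_le.trans_lt (mk_Iio_toType_lt a))
  exact ⟨w, hw, fun t ht hwt b hb => hy b t ht (_root_.trans (hfw _ (mem_image_of_mem f hb)) hwt)⟩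

end EventuallyConstant

section Leaves

variable {κ : Cardinal.{u}} {α : (κ.ord.ToType → Bool) → κ.ord.ToType}

/-- Without a small cofinal subset, `S` is `(<κ)`-directed and converges to some `y`. Its members
beyond some `s` lie in the cylinder of `y` of length `α y`, whose only leaf is `cut y (α y)`; so `s`
is last and `{s}` is cofinal. A general `r` covers both the order and its reverse. -/
theorem exists_small_cofinal (hκ : 1 < κ)
    (hα : ∀ x y, (∀ b < α x, y b = x b) → α y = α x)
    (r : (κ.ord.ToType → Bool) → (κ.ord.ToType → Bool) → Prop) [IsTrans _ r] [Std.Total r] (c : Bool)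
    (hc : ∀ s t b, r s t → (∀ i < b, s i = t i) → s b = c → t b = c)
    (S : Set {x : κ.ord.ToType → Bool // cut x (α x) = x}) :
    ∃ C ⊆ S, #C < κ ∧ ∀ s ∈ S, ∃ c ∈ C, r s.1 c.1 := by
  by_contra! h
  have hdir : ∀ C ⊆ Subtype.val '' S, #C < κ → ∃ u ∈ Subtype.val '' S, ∀ s ∈ C, r s u := by
    intro C hCS hC
    obtain ⟨w, hw, h⟩ := h (Subtype.val ⁻¹' C)
      (fun x hx => by simpa [x.2] using hCS hx)
      ((Cardinal.mk_preimage_of_injective _ _ Subtype.val_injective).trans_lt hC)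
    refine ⟨w, mem_image_of_mem _ hw, fun s hs => (total_of r s w).resolve_right ?_⟩
    obtain ⟨s, -, rfl⟩ := hCS hs
    exact h s hs
  obtain ⟨y, hy⟩ := exists_limit_of_directed r c hc hdir
  obtain ⟨_, ⟨s, hs, rfl⟩, hsy⟩ := hy (α y)
  have heq : ∀ t ∈ S, r s t → t = cut y (α y) := by
    intro t ht hst
    have := hsy t (mem_image_of_mem _ ht) hst
    rw [← t.2, hα y t this]
    exact cut_congr this
  obtain ⟨t, ht, hts⟩ := h {s} (by simpa using hs) (by simpa using hκ)
  have hts : ¬ r t s := hts s rfl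
  have hst : r s t := (total_of r s t).resolve_right hts
  have hss : r s s := (total_of r s s).elim id id
  rw [heq t ht hst, ← heq s hs hss] at hts
  exact hts hss

theorem cut_le_self (x : Lex (κ.ord.ToType → Bool)) (a : κ.ord.ToType) : toLex (cut x a) ≤ x := by
  by_contra h
  obtain ⟨b, -, hb⟩ := not_le.1 h
  have hb : x b < cut x a b := hb
  rcases lt_or_ge b a with hba | hba
  · exact lt_irrefl _ (hb.trans_eq (cut_of_lt hba))
  · exact not_lt_bot (hb.trans_eq (cut_of_le hba))

/-- The cut of `y` is the least sequence sharing that initial segment, so everything between it and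
`y` shares the segment too. -/
theorem eq_of_cut_le {x y : Lex (κ.ord.ToType → Bool)} {a : κ.ord.ToType}
    (h : toLex (cut y a) ≤ x) (hxy : x ≤ y) : ∀ b < a, x b = y b := by
  intro b
  induction b using WellFoundedLT.induction with
  | ind b ih =>
    intro hb
    have ih : ∀ i < b, x i = y i := fun i hi => ih i hi (hi.trans hb)
    refine le_antisymm (Pi.apply_le_of_toLex (x := x) (y := y) hxy ih) ?_
    have := Pi.apply_le_of_toLex (x := cut y a) (y := x) h (i := b) fun i hi =>
      (cut_of_lt (hi.trans hb)).trans (ih i hi).symm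
    exact (cut_of_lt hb).ge.trans this

/-- Take the supremum `y` among all sequences and round it down to the leaf of its cylinder. A
member of `A` above that leaf would lie in the same cylinder, hence equal it. -/
theorem exists_isLUB_leaves (hα : ∀ x y, (∀ b < α x, y b = x b) → α y = α x)
    (A : Set {x : Lex (κ.ord.ToType → Bool) // cut x (α x) = x}) : ∃ l, IsLUB A l := by
  obtain ⟨y, hy⟩ := exists_isLUB_lex_bool (Subtype.val '' A)
  have hαy : α (cut y (α y)) = α y := hα y _ fun b hb => cut_of_lt hb
  refine ⟨⟨toLex (cut y (α y)), ?_⟩, fun s hs => ?_, fun z hz => ?_⟩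
  · exact (congrArg _ hαy).trans (cut_congr fun b hb => cut_of_lt hb)
  · by_contra h
    have hlt : toLex (cut y (α y)) < s.1 := not_le.1 h
    have := eq_of_cut_le hlt.le (hy.1 (mem_image_of_mem _ hs))
    have hs' : s.1 = toLex (cut y (α y)) := by
      rw [← s.2, hα y _ this]
      exact cut_congr this
    exact hlt.ne hs'.symm
  · exact (cut_le_self y _).trans (hy.2 (forall_mem_image.2 fun s hs => hz hs))

end Leaves

/-- If products of two `(<κ)`-compact GO-spaces of weight at most `κ` are `(<κ)`-compact, then
`2 ^ κ` is `(<κ)`-compact in the `(<κ)`-box topology. -/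
theorem ltCompact_of_goSpace_prod {κ : Cardinal.{u}} (hκ : κ ^< κ = κ) (hω : ℵ₀ < κ)
    (h : ∀ (X Y : Type u) [TopologicalSpace X] [LinearOrder X] [GOSpace X]
        [TopologicalSpace Y] [LinearOrder Y] [GOSpace Y],
        LtCompact κ X → topWeight X ≤ κ → LtCompact κ Y → topWeight Y ≤ κ →
          LtCompact κ (X × Y)) :
    LtCompact κ (BoxProduct κ (fun _ : κ.ord.ToType => Bool)) := by
  have hr := isRegular_of_powerlt_eq hκ hω
  have h1 : 1 < κ := Cardinal.one_lt_aleph0.trans hω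
  intro 𝒰 hU hcov
  by_contra! hno
  -- The least length at which the cylinder around `x` fits inside a member of the cover; minimality
  -- makes it constant on that cylinder.
  have hex : ∀ x : κ.ord.ToType → Bool, ∃ a, (∃ V ∈ 𝒰, ∀ y : κ.ord.ToType → Bool,
      (∀ b < a, y b = x b) → y ∈ V) ∧ ∀ a', (∃ V ∈ 𝒰, ∀ y : κ.ord.ToType → Bool,
      (∀ b < a', y b = x b) → y ∈ V) → a ≤ a' := by
    intro x
    obtain ⟨V, hV, hx⟩ := (hcov ▸ mem_univ x : x ∈ ⋃₀ 𝒰)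
    obtain ⟨a, ha⟩ := exists_cylinder_subset hr (hU V hV) hx
    obtain ⟨m, hm, hmin⟩ := WellFounded.has_min (wellFounded_lt (α := κ.ord.ToType))
      {a | ∃ V ∈ 𝒰, ∀ y : κ.ord.ToType → Bool, (∀ b < a, y b = x b) → y ∈ V} ⟨a, V, hV, ha⟩
    exact ⟨m, hm, fun a' ha' => not_lt.1 (hmin a' ha')⟩
  choose α hα' hmin using hex
  choose V hV𝒰 hV using hα'
  have hle : ∀ x y, (∀ b < α x, y b = x b) → α y ≤ α x := fun x y hxy =>
    hmin y _ ⟨V x, hV𝒰 x, fun z hz => hV x z fun b hb => (hz b hb).trans (hxy b hb)⟩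
  have hα : ∀ x y, (∀ b < α x, y b = x b) → α y = α x := fun x y hxy =>
    (hle x y hxy).antisymm (hle y x fun b hb => (hxy b (hb.trans_le (hle x y hxy))).symm)
  let L : Type u := {x : Lex (κ.ord.ToType → Bool) // cut x (α x) = x}
  have hLκ : #L ≤ κ := by
    refine le_trans (Cardinal.mk_le_mk_of_subset (t := range
      fun p : Σ a : κ.ord.ToType, (Iio a → Bool) => (fun b => if h : b < p.1 then p.2 ⟨b, h⟩ else
        false : κ.ord.ToType → Bool)) fun x hx => ?_) (Cardinal.mk_range_le.trans
      (mk_sigma_Iio_bool_le hκ hω))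
    refine ⟨⟨α x, fun b => x b⟩, Eq.trans ?_ hx⟩
    funext b
    simp [cut]
  -- The sets `V l` for leaves `l` already cover, so fewer than `κ` leaves would give a small
  -- subcover.
  have hκL : κ ≤ #L := by
    by_contra! hlt
    refine hno (range fun l : L => V l.1) (range_subset_iff.2 fun l => hV𝒰 _)
      (Cardinal.mk_range_le.trans_lt hlt) (eq_univ_of_forall fun x => ?_)
    have hαx : α (cut x (α x)) = α x := hα x _ fun b hb => cut_of_lt hb
    refine ⟨_, ⟨⟨toLex (cut x (α x)), ?_⟩, rfl⟩, hV _ x fun b hb => ?_⟩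
    · exact (congrArg _ hαx).trans (cut_congr fun b hb => cut_of_lt hb)
    · exact (cut_of_lt (hb.trans_eq hαx)).symm
  have hlub : ∀ A : Set L, ∃ l, IsLUB A l := exists_isLUB_leaves hα
  have hglb : ∀ A : Set Lᵒᵈ, ∃ l, IsLUB A l := by
    intro A
    obtain ⟨l, hl⟩ := hlub (lowerBounds (OrderDual.toDual ⁻¹' A))
    exact ⟨OrderDual.toDual l, isLUB_lowerBounds.1 hl⟩
  have hcof : ∀ S : Set L, ∃ C ⊆ S, #C < κ ∧ ∀ s ∈ S, ∃ c ∈ C, s ≤ c :=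
    have : IsTrans _ fun s t : κ.ord.ToType → Bool => toLex s ≤ toLex t :=
      ⟨fun _ _ _ h h' => h.trans h'⟩
    have : Std.Total fun s t : κ.ord.ToType → Bool => toLex s ≤ toLex t :=
      ⟨fun s t => le_total (toLex s) (toLex t)⟩
    exists_small_cofinal h1 hα (fun s t => toLex s ≤ toLex t) true fun s t b hst hb hs => by
      have := Pi.apply_le_of_toLex hst hb
      rw [hs] at this
      exact top_le_iff.1 this
  have hcof' : ∀ S : Set Lᵒᵈ, ∃ C ⊆ S, #C < κ ∧ ∀ s ∈ S, ∃ c ∈ C, s ≤ c :=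
    have : IsTrans _ fun s t : κ.ord.ToType → Bool => toLex t ≤ toLex s :=
      ⟨fun _ _ _ h h' => h'.trans h⟩
    have : Std.Total fun s t : κ.ord.ToType → Bool => toLex t ≤ toLex s :=
      ⟨fun s t => le_total (toLex t) (toLex s)⟩
    exists_small_cofinal h1 hα (fun s t => toLex t ≤ toLex s) false fun s t b hst hb hs => by
      have := Pi.apply_le_of_toLex hst fun i hi => (hb i hi).symm
      rw [hs] at this
      exact le_bot_iff.1 this
  exact (Sorgenfrey.mk_lt_of_ltCompact_prod (L := L) (h _ _
    (Sorgenfrey.ltCompact hr hlub hcof) (Sorgenfrey.topWeight_le hω.le hLκ)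
    (Sorgenfrey.ltCompact (L := Lᵒᵈ) hr hglb hcof') (Sorgenfrey.topWeight_le hω.le hLκ))).not_ge hκL

/-- `X × Y` is a closed subspace of the square of `X ⊕ Y`; orders play no role. -/
theorem ltCompact_goSpace_prod_of_weaklySquareCompact {κ : Cardinal.{u}} (hω : ℵ₀ < κ)
    (h : WeaklySquareCompact κ) {X Y : Type u} [TopologicalSpace X] [T2Space X]
    [TopologicalSpace Y] [T2Space Y] (hX : LtCompact κ X) (hXw : topWeight X ≤ κ)
    (hY : LtCompact κ Y) (hYw : topWeight Y ≤ κ) : LtCompact κ (X × Y) :=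
  (h (X ⊕ Y) (hX.sum hω hY) (topWeight_sum_le hω hXw hYw)).of_isClosedEmbedding
    (Topology.IsClosedEmbedding.inl.prodMap Topology.IsClosedEmbedding.inr)

theorem theorem5p1 (κ : Cardinal.{u}) (hκ : κ ^< κ = κ) (hω : ℵ₀ < κ) :
    List.TFAE [
      IsWeaklyCompactCardinal κ,
      ∀ (ι : Type u) (X : ι → Type u) [∀ i, TopologicalSpace (X i)] [∀ i, T2Space (X i)],
        #ι ≤ κ → (∀ i, LtCompact κ (X i)) → (∀ i, topWeight (X i) ≤ κ) →
          LtCompact κ (BoxProduct κ X),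
      LtCompact κ (BoxProduct κ (fun _ : κ.ord.ToType => Bool)),
      FilterExtensionProperty κ κ,
      ∀ (ι : Type u) (X : ι → Type u) [∀ i, TopologicalSpace (X i)] [∀ i, T2Space (X i)],
        #ι ≤ κ → (∀ i, LtCompact κ (X i)) → (∀ i, topWeight (X i) ≤ κ) →
          LtCompact κ (∀ i, X i),
      WeaklySquareCompact κ,
      ∀ (X Y : Type u) [TopologicalSpace X] [LinearOrder X] [GOSpace X]
        [TopologicalSpace Y] [LinearOrder Y] [GOSpace Y],
        LtCompact κ X → topWeight X ≤ κ → LtCompact κ Y → topWeight Y ≤ κ →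
          LtCompact κ (X × Y)] := by
  have hr := isRegular_of_powerlt_eq hκ hω
  tfae_have 1 → 2 := fun h ι X _ _ hι hX hw => h.ltCompact_boxProduct hι hX hw
  tfae_have 2 → 3 := fun h =>
    (h κ.ord.ToType (fun _ => ULift.{u} Bool) (Cardinal.mk_ord_toType κ).le
      (fun _ => ltCompact_of_finite hω) (fun _ => topWeight_le_of_finite hω)).of_surjective
      (BoxProduct.continuous_map fun _ => continuous_uliftDown)
      fun y => ⟨fun i => ⟨y i⟩, rfl⟩
  tfae_have 3 → 1 := isWeaklyCompactCardinal_of_ltCompact hr hω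
  tfae_have 1 → 4 := fun h => h.filterExtensionProperty
  tfae_have 4 → 3 := ltCompact_of_filterExtensionProperty hκ hω
  tfae_have 2 → 5 := fun h ι X _ _ hι hX hw => (h ι X hι hX hw).of_surjective
    (BoxProduct.continuous_id (Cardinal.one_lt_aleph0.trans hω)) fun x => ⟨x, rfl⟩
  tfae_have 5 → 6 := fun h X _ _ hX hw =>
    (h (ULift.{u} Bool) (fun _ => X) ((Cardinal.mk_lt_aleph0).trans hω).le (fun _ => hX)
      fun _ => hw).of_surjective (f := fun x => (x ⟨true⟩, x ⟨false⟩)) (by fun_prop)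
      fun p => ⟨fun b => bif b.down then p.1 else p.2, rfl⟩
  tfae_have 6 → 7 := fun h X Y _ _ _ _ _ _ hX hXw hY hYw =>
    ltCompact_goSpace_prod_of_weaklySquareCompact hω h hX hXw hY hYw
  tfae_have 7 → 3 := ltCompact_of_goSpace_prod hκ hω
  tfae_finish
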